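/- Work over $\mathbb{C}$. Let $D=\frac{d}{dx}$ and $\theta=xD$ act on $\mathbb{C}[x]$; for a sequence $(h_n)_{n\ge 0}$ let $h_\theta$ be the operator $h_\theta x^n=h_nx^n$, let $h_\theta\cdot\ell=\sum_n h_n\ell_n y^n$ for a formal power series $\ell=\sum_n \ell_n y^n$, and let $\ell(D)=\sum_k\ell_kD^k$. For a series $f(y)\in y+y^2\mathbb{C}[[y]]$ let $f^{inv}$ be its compositional inverse and let $C_f$ be the operator $C_fx^n=p_n(x)$, where $(p_n)$ is the family of binomial type with $e^{xy}=\sum_n p_n(x)f(y)^n/n!$. A complex power of a series with constant term $1$ is given by the binomial series. Write $(z)_n=z(z-1)\cdots(z-n+1)$. Let $a,b,\lambda,c\in\mathbb{C}$ with $\lambda\neq 0$, $c\notin\{-1,-2,\dots\}$ and $1+\lambda(n+c)\ne 0$ for all integers $n\ge 0$. Let $f$ be the formal power series with $f(0)=0$ and $f'=1+\lambda af+\lambda bf^2$, let $\omega=(f/f')^{inv}$, and put $$\mathcal F_n=\lambda^{-n}\frac{\Gamma(c+1/\lambda)}{\Gamma(c+n+1/\lambda)},\qquad H_n=(c+n-1)_n,\qquad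 \ell(y)=\omega'(y)\,f'(\omega(y))^{c+1/\lambda-1}.$$ The associated ultraspherical polynomials $p_n(x,c)$ are the monic polynomials with $p_0=1$, $p_1=x-a$ and, for $n\ge 1$, $$p_{n+1}(x,c)=(x-a)\,p_n(x,c)-b\,\frac{(n+c)(2+\lambda(n-1+c))}{(1+\lambda(n-1+c))(1+\lambda(n+c))}\,p_{n-1}(x,c).$$ Then the operator $$G_Q(c)=\theta!\,(H_\theta\mathcal F_\theta\cdot\ell)(D)\,(c+\theta)_\theta^{-1}\mathcal F_\theta^{-1}C_{f/f'}^{-1}f'(D)^{-c-1/\lambda}C_f\,\mathcal F_\theta\,\frac{(c+\theta)_\theta}{\theta!}$$ is well defined and invertible, $G_Q(c)x^n=p_n(x,c)$ for all $n\ge0$, and the dual raising operator $U_{Q^*}(c)=G_Q(c)^{-1}\,x\,G_Q(c)$ is $$U_{Q^*}(c)=\mathcal F_\theta^{-1}U_{P^*}(c)\mathcal F_{\theta+1}=x+a+b\,\frac{(2+\lambda(\theta+c))(1+\theta+c)}{(1+\theta)(1+\lambda(\theta+c))(1+\lambda(\theta+c+1))}\,D,$$ where $U_{P^*}(c)=x+a(1+\lambda(\theta+c))+b\,\frac{(2+\lambda(\theta+c))(1+\theta+c)}{1+\theta}D$.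 -/

import Mathlib

noncomputable section

namespace UltrasphericalAssociated

open Polynomial

/-! ### Linear operators on `ℂ[X]` -/

/-- The algebra (under composition) of linear operators acting on polynomials in `x`. -/
abbrev PolyOp : Type := Module.End ℂ ℂ[X]

/-- The linear operator sending `x ^ n` to `p n`. -/
def ofMonomials (p : ℕ → ℂ[X]) : PolyOp := (Polynomial.basisMonomials ℂ).constr ℂ p

theorem ofMonomials_X_pow (p : ℕ → ℂ[X]) (n : ℕ) : ofMonomials p (X ^ n) = p n := by
  have h := (Polynomial.basisMonomials ℂ).constr_basis ℂ p n
  rw [Polynomial.coe_basisMonomials] at h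
  rw [← Polynomial.monomial_one_right_eq_X_pow]
  exact h

/-- Multiplication by `x`. -/
def mulX : PolyOp := LinearMap.mulLeft ℂ (X : ℂ[X])

/-- The derivative `D = d/dx`. -/
def D : PolyOp := Polynomial.derivative

/-- The diagonal operator `h_θ`, sending `x ^ n` to `h n • x ^ n`. -/
def diag (h : ℕ → ℂ) : PolyOp := ofMonomials fun n => h n • X ^ n

/-- The operator `ℓ(D) = ∑ k, ℓ_k D ^ k`; on `x ^ n` only the terms with `k ≤ n` contribute. -/
def ofD (l : PowerSeries ℂ) : PolyOp :=
  ofMonomials fun n => ∑ k ∈ Finset.range (n + 1), PowerSeries.coeff k l • (D ^ k) (X ^ n)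

/-! ### Power series -/

/-- The compositional inverse of a series `f` with `f(0) = 0` and `f'(0) ≠ 0`. -/
def compInv (f : PowerSeries ℂ) : PowerSeries ℂ :=
  open Classical in
  if h : IsUnit (PowerSeries.coeff 1 f) then PowerSeries.substInvOfIsUnit f h else 0

theorem subst_compInv (f : PowerSeries ℂ) (h0 : PowerSeries.constantCoeff f = 0)
    (h1 : PowerSeries.coeff 1 f ≠ 0) : f.subst (compInv f) = PowerSeries.X := by
  rw [compInv, dif_pos h1.isUnit]
  exact PowerSeries.subst_substInvOfIsUnit_right f h0 _

/-- The complex power `g ^ s = ∑ k, binom(s, k) (g - 1) ^ k` of a series `g` with `g(0) = 1`. -/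
def cpow (g : PowerSeries ℂ) (s : ℂ) : PowerSeries ℂ :=
  (PowerSeries.binomialSeries ℂ s).subst (g - 1)

/-- The action `h_θ · ℓ` of a diagonal operator on a power series. -/
def diagSeries (h : ℕ → ℂ) (l : PowerSeries ℂ) : PowerSeries ℂ :=
  PowerSeries.mk fun n => h n * PowerSeries.coeff n l

/-- The transform `f ↦ f / f'`. -/
def frakT (f : PowerSeries ℂ) : PowerSeries ℂ := f * (PowerSeries.derivative ℂ f)⁻¹

/-- The umbral operator `C_f`, sending `x ^ n` to the `n`-th polynomial `p_n` of the family of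
binomial type given by `e ^ (x y) = ∑ n, p_n(x) f(y) ^ n / n!`. Substituting the compositional
inverse `φ` of `f` for `y`, this says `e ^ (x φ(y)) = ∑ n, p_n(x) y ^ n / n!`, so that the
coefficient of `x ^ k` in `p_n` is `(n! / k!) [y ^ n] φ(y) ^ k`. -/
def umbral (f : PowerSeries ℂ) : PolyOp :=
  ofMonomials fun n => ∑ k ∈ Finset.range (n + 1),
    ((n.factorial : ℂ) / (k.factorial : ℂ) * PowerSeries.coeff n (compInv f ^ k)) • X ^ k

/-- The coefficients of the series `f` with `f(0) = 0` and `f' = 1 + λ a f + λ b f ^ 2`. -/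
def baseCoeff (a b lam : ℂ) : ℕ → ℂ
  | 0 => 0
  | n + 1 => ((if n = 0 then 1 else 0) + lam * a * baseCoeff a b lam n +
      lam * b * ∑ i : Fin (n + 1), baseCoeff a b lam i * baseCoeff a b lam (n - i)) / (n + 1)
  termination_by n => n
  decreasing_by all_goals omega

/-- The series `f` with `f(0) = 0` and `f' = 1 + λ a f + λ b f ^ 2`. -/
def baseSeries (a b lam : ℂ) : PowerSeries ℂ := PowerSeries.mk (baseCoeff a b lam)

theorem constantCoeff_baseSeries (a b lam : ℂ) :
    PowerSeries.constantCoeff (baseSeries a b lam) = 0 := by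
  rw [← PowerSeries.coeff_zero_eq_constantCoeff_apply, baseSeries, PowerSeries.coeff_mk, baseCoeff]

theorem derivative_baseSeries (a b lam : ℂ) :
    PowerSeries.derivative ℂ (baseSeries a b lam) =
      1 + PowerSeries.C (lam * a) * baseSeries a b lam +
        PowerSeries.C (lam * b) * baseSeries a b lam ^ 2 := by
  ext n
  have hn : (n : ℂ) + 1 ≠ 0 := Nat.cast_add_one_ne_zero n
  rw [PowerSeries.coeff_derivative, baseSeries, PowerSeries.coeff_mk, baseCoeff]
  rw [div_mul_cancel₀ _ hn, map_add, map_add, PowerSeries.coeff_C_mul, PowerSeries.coeff_C_mul,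
    PowerSeries.coeff_mk, PowerSeries.coeff_one, sq, PowerSeries.coeff_mul,
    Finset.Nat.sum_antidiagonal_eq_sum_range_succ_mk, ← Fin.sum_univ_eq_sum_range
      (fun k => PowerSeries.coeff k (PowerSeries.mk (baseCoeff a b lam)) *
        PowerSeries.coeff (n - k) (PowerSeries.mk (baseCoeff a b lam)))]
  simp only [PowerSeries.coeff_mk]

/-! ### Associated families -/

/-- The monic polynomials associated with parameter `c` to the orthogonal family with recurrence
coefficients `A`, `B`, i.e. `x p_n = p_{n+1} + A(n) p_n + n B(n) p_{n-1}`; the index `n` of the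
coefficients is shifted to `n + c`. -/
def assocPoly (A B : ℂ → ℂ) (c : ℂ) : ℕ → ℂ[X]
  | 0 => 1
  | 1 => X - C (A c)
  | n + 2 => (X - C (A (n + 1 + c))) * assocPoly A B c (n + 1) -
      C ((n + 1 + c) * B (n + 1 + c)) * assocPoly A B c n

/-- The operator `x + A(θ + c) + ((1 + c + θ) B(θ + c + 1) / (1 + θ)) D`. -/
def assocRaising (A B : ℂ → ℂ) (c : ℂ) : PolyOp :=
  mulX + diag (fun n => A (n + c)) +
    diag (fun n => (1 + c + n) * B (n + c + 1) / (1 + n)) * D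

/-- The ultraspherical coefficient `a_θ = a`. -/
def ultraA (a : ℂ) : ℂ → ℂ := fun _ => a

/-- The ultraspherical coefficient `b_θ`, so that
`b_{θ+1} = b (2 + λ θ) / ((1 + λ θ) (1 + λ + λ θ))`. -/
def ultraB (b lam : ℂ) : ℂ → ℂ := fun z =>
  b * (2 + lam * (z - 1)) / ((1 + lam * (z - 1)) * (1 + lam * z))

/-- The associated Sheffer dual raising operator
`x + a (1 + λ (θ + c)) + b ((2 + λ (θ + c)) (1 + θ + c) / (1 + θ)) D`. -/
def shefferRaising (a b lam c : ℂ) : PolyOp :=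
  assocRaising (fun z => a * (1 + lam * z)) (fun z => b * (2 + lam * (z - 1))) c

/-! ### The explicit operator -/

/-- `F_n = λ ^ (-n) Γ(c + 1/λ) / Γ(c + n + 1/λ)`. -/
def seqF (lam c : ℂ) (n : ℕ) : ℂ :=
  (lam ^ n)⁻¹ * (Complex.Gamma (c + 1 / lam) / Complex.Gamma (c + n + 1 / lam))

/-- `(c + n)_n`, with `(z)_n = z (z - 1) ⋯ (z - n + 1)` the falling factorial. -/
def seqFall (c : ℂ) (n : ℕ) : ℂ := (descPochhammer ℂ n).eval (c + n)

/-- `H_n = (c + n - 1)_n`. -/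
def seqH (c : ℂ) (n : ℕ) : ℂ := (descPochhammer ℂ n).eval (c + n - 1)

/-- The series `ω`, the compositional inverse of `f / f'`. -/
def omegaSeries (a b lam : ℂ) : PowerSeries ℂ := compInv (frakT (baseSeries a b lam))

/-- The series `ℓ = ω' f'(ω) ^ (c + 1/λ - 1)`. -/
def ellSeries (a b lam c : ℂ) : PowerSeries ℂ :=
  PowerSeries.derivative ℂ (omegaSeries a b lam) *
    cpow ((PowerSeries.derivative ℂ (baseSeries a b lam)).subst (omegaSeries a b lam))
      (c + 1 / lam - 1)

open scoped Ring in
/-- The operator `G_Q(c) = θ! (H_θ F_θ · ℓ)(D) (c+θ)_θ⁻¹ F_θ⁻¹ C_{f/f'}⁻¹ f'(D)^(-c-1/λ) C_f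
F_θ (c+θ)_θ / θ!`. Here `⁻¹ʳ` is the inverse of an operator (and `0` if there is none). -/
def opG (a b lam c : ℂ) : PolyOp :=
  diag (fun n => (n.factorial : ℂ)) *
    ofD (diagSeries (fun n => seqH c n * seqF lam c n) (ellSeries a b lam c)) *
    (diag (seqFall c))⁻¹ʳ * (diag (seqF lam c))⁻¹ʳ *
    (umbral (frakT (baseSeries a b lam)))⁻¹ʳ *
    ofD (cpow (PowerSeries.derivative ℂ (baseSeries a b lam)) (-c - 1 / lam)) *
    umbral (baseSeries a b lam) *
    diag (seqF lam c) * diag (seqFall c) * (diag (fun n => (n.factorial : ℂ)))⁻¹ʳ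

end UltrasphericalAssociated

end

namespace UltrasphericalAssociated
open Polynomial
open scoped Ring

/-! Everything is transposed to power series through a nondegenerate pairing: `x` becomes `d/dy`,
`h_θ` a coefficientwise product, `m(D)` multiplication by `m`, and `C_f` substitution of the inverse
of `f`. By `pairing_opG`, the transpose of `G_Q(c)` sends `l` to `R = Q^(-c-1/λ) r(u)` with
coefficients rescaled by `F_n (c+n)_n`, where `Q = 1 + λ a y + λ b y²`, `u = y/Q` and `r` is
`innerSeries` of `l`. Write `r₂`, `R₂` for the series built from `l'` and `θ = y d/dy`. The diagonal
factors are chosen so that `(c+θ) r - y (1+λ(c+θ)) r₂ = l(0) c ℓ` (`innerSeries_equation`).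
Substituting `u` and multiplying by the power of `Q` turns this into `(Q (c+θ) + a y + 2 b y²) R - y
(1+λ(c+θ)) R₂ = l(0) c` (`outerSeries_equation`); `ℓ` is chosen to make the right side constant.
Positive-degree coefficients are the three-term recurrence for `G_Q(c) x^n`, hence `x G = G U`.
Conjugation by `F` then only uses the ratio `F_n / F_{n+1} = 1 + λ(n+c)`. -/

/-! ### Transposes of the basic operators. -/

/-- The pairing `⟨ℓ, p⟩ = (ℓ(D) p)(0)`, so that `⟨ℓ, x ^ n⟩ = n! ℓ_n`. -/
noncomputable def pairing (l : PowerSeries ℂ) : ℂ[X] →ₗ[ℂ] ℂ :=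
  (Polynomial.basisMonomials ℂ).constr ℂ fun n => PowerSeries.coeff n l * n.factorial

theorem pairing_X_pow (l : PowerSeries ℂ) (n : ℕ) :
    pairing l (X ^ n) = PowerSeries.coeff n l * n.factorial := by
  have h := (Polynomial.basisMonomials ℂ).constr_basis ℂ
    (fun n : ℕ => PowerSeries.coeff n l * (n.factorial : ℂ)) n
  rw [Polynomial.coe_basisMonomials] at h
  rw [← Polynomial.monomial_one_right_eq_X_pow]
  exact h

theorem linearMap_ext_X_pow {M : Type*} [AddCommMonoid M] [Module ℂ M] {A B : ℂ[X] →ₗ[ℂ] M}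
    (h : ∀ n : ℕ, A (X ^ n) = B (X ^ n)) : A = B := by
  refine Polynomial.lhom_ext' fun n => LinearMap.ext_ring ?_
  simpa [Polynomial.monomial_one_right_eq_X_pow] using h n

theorem pairing_eq_sum (l : PowerSeries ℂ) (p : ℂ[X]) :
    pairing l p = p.sum fun n r => r * (PowerSeries.coeff n l * n.factorial) := by
  conv_lhs => rw [p.as_sum_support_C_mul_X_pow]
  rw [map_sum, Polynomial.sum_def]
  refine Finset.sum_congr rfl fun n _ => ?_
  rw [← Polynomial.smul_eq_C_mul, map_smul, pairing_X_pow, smul_eq_mul]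

/-- Pairing with `y ^ n` reads off `n!` times the `n`-th coefficient, so operators can be compared
through their transposes. -/
theorem pairing_ext {p q : ℂ[X]} (h : ∀ l, pairing l p = pairing l q) : p = q := by
  have key : ∀ (p : ℂ[X]) (n : ℕ),
      pairing (PowerSeries.mk fun k => if k = n then 1 else 0) p = p.coeff n * n.factorial := by
    intro p n
    rw [pairing_eq_sum, Polynomial.sum_def, Finset.sum_eq_single n]
    · simp
    · intro k _ hk
      simp [hk]
    · intro hn
      simp [Polynomial.notMem_support_iff.1 hn]
  ext n
  have h' := h (PowerSeries.mk fun k => if k = n then 1 else 0)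
  rw [key, key] at h'
  exact mul_right_cancel₀ (by exact_mod_cast n.factorial_ne_zero) h'

theorem pairing_mulX (l : PowerSeries ℂ) (p : ℂ[X]) :
    pairing l (mulX p) = pairing (PowerSeries.derivative ℂ l) p := by
  suffices pairing l ∘ₗ mulX = pairing (PowerSeries.derivative ℂ l) from
    LinearMap.congr_fun this p
  refine linearMap_ext_X_pow fun n => ?_
  rw [LinearMap.comp_apply, mulX, LinearMap.mulLeft_apply, ← pow_succ', pairing_X_pow,
    pairing_X_pow, PowerSeries.coeff_derivative, Nat.factorial_succ]
  push_cast
  ring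

theorem diag_X_pow (h : ℕ → ℂ) (n : ℕ) : diag h (X ^ n) = h n • X ^ n :=
  ofMonomials_X_pow _ n

theorem pairing_diag (h : ℕ → ℂ) (l : PowerSeries ℂ) (p : ℂ[X]) :
    pairing l (diag h p) = pairing (diagSeries h l) p := by
  suffices pairing l ∘ₗ diag h = pairing (diagSeries h l) from LinearMap.congr_fun this p
  refine linearMap_ext_X_pow fun n => ?_
  rw [LinearMap.comp_apply, diag_X_pow, map_smul, pairing_X_pow, pairing_X_pow, diagSeries,
    PowerSeries.coeff_mk, smul_eq_mul, mul_assoc]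

theorem D_pow_X_pow (k n : ℕ) :
    (D ^ k) (X ^ n : ℂ[X]) = (n.descFactorial k : ℂ) • X ^ (n - k) := by
  rw [D, Module.End.pow_apply, Polynomial.iterate_derivative_X_pow_eq_smul, Nat.cast_smul_eq_nsmul]

/-- The weight `n!` is what makes this a Cauchy product: the falling factorial from `D ^ k x ^ n`
times `(n-k)!` is `n!`. -/
theorem pairing_ofD (m l : PowerSeries ℂ) (p : ℂ[X]) :
    pairing l (ofD m p) = pairing (m * l) p := by
  suffices pairing l ∘ₗ ofD m = pairing (m * l) from LinearMap.congr_fun this p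
  refine linearMap_ext_X_pow fun n => ?_
  rw [LinearMap.comp_apply, ofD, ofMonomials_X_pow, map_sum, pairing_X_pow, PowerSeries.coeff_mul,
    Finset.Nat.sum_antidiagonal_eq_sum_range_succ_mk, Finset.sum_mul]
  refine Finset.sum_congr rfl fun k hk => ?_
  have hk' : k ≤ n := Nat.lt_succ_iff.1 (Finset.mem_range.1 hk)
  rw [D_pow_X_pow, map_smul, map_smul, pairing_X_pow, ← Nat.factorial_mul_descFactorial hk']
  push_cast
  simp only [smul_eq_mul]
  ring

/-! ### Compositional inverses and the transpose of `C_f`. -/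

theorem hasSubst_of_constantCoeff {g : PowerSeries ℂ} (h : PowerSeries.constantCoeff g = 0) :
    PowerSeries.HasSubst g :=
  PowerSeries.HasSubst.of_constantCoeff_zero' h

theorem constantCoeff_compInv (f : PowerSeries ℂ) : PowerSeries.constantCoeff (compInv f) = 0 := by
  rw [compInv]
  split_ifs with h
  · exact PowerSeries.constantCoeff_substInvOfIsUnit f h
  · simp

theorem hasSubst_compInv (f : PowerSeries ℂ) : PowerSeries.HasSubst (compInv f) :=
  hasSubst_of_constantCoeff (constantCoeff_compInv f)

theorem compInv_subst (f : PowerSeries ℂ) (h0 : PowerSeries.constantCoeff f = 0)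
    (h1 : PowerSeries.coeff 1 f ≠ 0) : (compInv f).subst f = PowerSeries.X := by
  rw [compInv, dif_pos h1.isUnit]
  exact PowerSeries.subst_substInvOfIsUnit_left f h0 _

theorem coeff_one_compInv (f : PowerSeries ℂ) (h1 : PowerSeries.coeff 1 f ≠ 0) :
    PowerSeries.coeff 1 (compInv f) ≠ 0 := by
  rw [compInv, dif_pos h1.isUnit, PowerSeries.coeff_one_substInvOfIsUnit]
  exact Units.ne_zero _

theorem subst_subst_compInv (f l : PowerSeries ℂ) (h0 : PowerSeries.constantCoeff f = 0)
    (h1 : PowerSeries.coeff 1 f ≠ 0) : PowerSeries.subst (compInv f) (PowerSeries.subst f l) = l := by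
  rw [PowerSeries.subst_comp_subst_apply (hasSubst_of_constantCoeff h0) (hasSubst_compInv f),
    subst_compInv f h0 h1, PowerSeries.X_subst]

theorem subst_compInv_subst (f l : PowerSeries ℂ) (h0 : PowerSeries.constantCoeff f = 0)
    (h1 : PowerSeries.coeff 1 f ≠ 0) : PowerSeries.subst f (PowerSeries.subst (compInv f) l) = l := by
  rw [PowerSeries.subst_comp_subst_apply (hasSubst_compInv f) (hasSubst_of_constantCoeff h0),
    compInv_subst f h0 h1, PowerSeries.X_subst]

/-- Associativity of composition: with `g` the inverse of `f` and `k` that of `g`, evaluating `f ∘ g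
∘ k` in two ways gives `k = f`. -/
theorem compInv_compInv (f : PowerSeries ℂ) (h0 : PowerSeries.constantCoeff f = 0)
    (h1 : PowerSeries.coeff 1 f ≠ 0) : compInv (compInv f) = f := by
  have h := subst_compInv_subst (compInv f) f (constantCoeff_compInv f) (coeff_one_compInv f h1)
  have h2 := subst_compInv (compInv f) (constantCoeff_compInv f) (coeff_one_compInv f h1)
  have h3 := PowerSeries.subst_comp_subst_apply (hasSubst_compInv f)
    (hasSubst_compInv (compInv f)) f
  rw [subst_compInv f h0 h1, h2, PowerSeries.X_subst,
    PowerSeries.subst_X (hasSubst_compInv (compInv f))] at h3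
  exact h3

theorem pairing_umbral (f l : PowerSeries ℂ) (p : ℂ[X]) :
    pairing l (umbral f p) = pairing (l.subst (compInv f)) p := by
  suffices pairing l ∘ₗ umbral f = pairing (l.subst (compInv f)) from LinearMap.congr_fun this p
  refine linearMap_ext_X_pow fun n => ?_
  rw [LinearMap.comp_apply, umbral, ofMonomials_X_pow, map_sum, pairing_X_pow,
    PowerSeries.coeff_subst' (hasSubst_compInv f),
    finsum_eq_sum_of_support_subset (s := Finset.range (n + 1)), Finset.sum_mul]
  · refine Finset.sum_congr rfl fun k _ => ?_
    rw [map_smul, pairing_X_pow, smul_eq_mul, smul_eq_mul]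
    have : (k.factorial : ℂ) ≠ 0 := by exact_mod_cast k.factorial_ne_zero
    field_simp
  · intro k hk
    rw [Function.mem_support] at hk
    rw [Finset.coe_range, Set.mem_Iio]
    by_contra hkn
    refine hk ?_
    -- Terms with `k > n` vanish because the inverse series has no constant term, so the finite sum
    -- defining `umbral` loses nothing.
    have hX : (PowerSeries.X : PowerSeries ℂ) ^ k ∣ compInv f ^ k :=
      pow_dvd_pow_of_dvd (PowerSeries.X_dvd_iff.2 (constantCoeff_compInv f)) k
    rw [PowerSeries.X_pow_dvd_iff.1 hX n (by omega), smul_zero]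

/-! ### Invertible factors -/

theorem linearMap_ext_pairing {A B : PolyOp} (h : ∀ l p, pairing l (A p) = pairing l (B p)) :
    A = B :=
  LinearMap.ext fun p => pairing_ext fun l => h l p

theorem isUnit_of_mul_eq_one_both {A B : PolyOp} (h : A * B = 1) (h' : B * A = 1) : IsUnit A :=
  ⟨⟨A, B, h, h'⟩, rfl⟩

theorem diag_mul_diag (h k : ℕ → ℂ) : diag h * diag k = diag fun n => h n * k n := by
  refine linearMap_ext_X_pow fun n => ?_
  rw [Module.End.mul_apply, diag_X_pow, map_smul, diag_X_pow, diag_X_pow, smul_smul, mul_comm]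

theorem diag_one : diag (fun _ => 1) = 1 :=
  linearMap_ext_X_pow fun n => by simp [diag_X_pow]

theorem diag_mul_diag_inv {h : ℕ → ℂ} (hh : ∀ n, h n ≠ 0) :
    diag h * diag (fun n => (h n)⁻¹) = 1 := by
  simp only [diag_mul_diag, mul_inv_cancel₀ (hh _), diag_one]

theorem isUnit_diag {h : ℕ → ℂ} (hh : ∀ n, h n ≠ 0) : IsUnit (diag h) :=
  isUnit_of_mul_eq_one_both (diag_mul_diag_inv hh) <| by
    simp only [diag_mul_diag, inv_mul_cancel₀ (hh _), diag_one]

theorem inverse_diag {h : ℕ → ℂ} (hh : ∀ n, h n ≠ 0) :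
    (diag h)⁻¹ʳ = diag fun n => (h n)⁻¹ := by
  rw [← mul_one (diag h)⁻¹ʳ, Ring.inverse_mul_eq_iff_eq_mul _ _ _ (isUnit_diag hh),
    diag_mul_diag_inv hh]

theorem ofD_mul (m m' : PowerSeries ℂ) : ofD m * ofD m' = ofD (m * m') :=
  linearMap_ext_pairing fun l p => by
    rw [Module.End.mul_apply, pairing_ofD, pairing_ofD, pairing_ofD, ← mul_assoc, mul_comm m']

theorem ofD_one : ofD 1 = 1 :=
  linearMap_ext_pairing fun l p => by rw [pairing_ofD, one_mul, Module.End.one_apply]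

theorem isUnit_ofD {m : PowerSeries ℂ} (hm : PowerSeries.constantCoeff m ≠ 0) : IsUnit (ofD m) :=
  isUnit_of_mul_eq_one_both (B := ofD m⁻¹)
    (by rw [ofD_mul, PowerSeries.mul_inv_cancel _ hm, ofD_one])
    (by rw [ofD_mul, PowerSeries.inv_mul_cancel _ hm, ofD_one])

theorem umbral_mul_umbral_compInv {f : PowerSeries ℂ} (h0 : PowerSeries.constantCoeff f = 0)
    (h1 : PowerSeries.coeff 1 f ≠ 0) : umbral f * umbral (compInv f) = 1 :=
  linearMap_ext_pairing fun l p => by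
    rw [Module.End.mul_apply, pairing_umbral, pairing_umbral, compInv_compInv f h0 h1,
      subst_compInv_subst f l h0 h1, Module.End.one_apply]

theorem umbral_compInv_mul_umbral {f : PowerSeries ℂ} (h0 : PowerSeries.constantCoeff f = 0)
    (h1 : PowerSeries.coeff 1 f ≠ 0) : umbral (compInv f) * umbral f = 1 :=
  linearMap_ext_pairing fun l p => by
    rw [Module.End.mul_apply, pairing_umbral, pairing_umbral, compInv_compInv f h0 h1,
      subst_subst_compInv f l h0 h1, Module.End.one_apply]

theorem isUnit_umbral {f : PowerSeries ℂ} (h0 : PowerSeries.constantCoeff f = 0)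
    (h1 : PowerSeries.coeff 1 f ≠ 0) : IsUnit (umbral f) :=
  isUnit_of_mul_eq_one_both (umbral_mul_umbral_compInv h0 h1) (umbral_compInv_mul_umbral h0 h1)

theorem inverse_umbral {f : PowerSeries ℂ} (h0 : PowerSeries.constantCoeff f = 0)
    (h1 : PowerSeries.coeff 1 f ≠ 0) : (umbral f)⁻¹ʳ = umbral (compInv f) := by
  rw [← mul_one (umbral f)⁻¹ʳ, Ring.inverse_mul_eq_iff_eq_mul _ _ _ (isUnit_umbral h0 h1),
    umbral_mul_umbral_compInv h0 h1]

/-! ### Complex powers -/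

theorem constantCoeff_subst_eq {g : PowerSeries ℂ} (hg : PowerSeries.constantCoeff g = 0)
    (l : PowerSeries ℂ) :
    PowerSeries.constantCoeff (PowerSeries.subst g l : PowerSeries ℂ) =
      PowerSeries.constantCoeff l := by
  rw [← PowerSeries.coeff_zero_eq_constantCoeff_apply,
    PowerSeries.coeff_subst' (hasSubst_of_constantCoeff hg), finsum_eq_single _ 0]
  · simp
  · intro n hn
    simp [hg, hn]

theorem subst_C_eq (g : PowerSeries ℂ) (r : ℂ) :
    PowerSeries.subst g (PowerSeries.C r : PowerSeries ℂ) = (PowerSeries.C r : PowerSeries ℂ) :=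
  PowerSeries.subst_C r

theorem subst_one_eq (g : PowerSeries ℂ) :
    PowerSeries.subst g (1 : PowerSeries ℂ) = (1 : PowerSeries ℂ) := by
  have h := subst_C_eq g 1
  rwa [map_one] at h

theorem hasSubst_sub_one {h : PowerSeries ℂ} (hh : PowerSeries.constantCoeff h = 1) :
    PowerSeries.HasSubst (h - 1) :=
  hasSubst_of_constantCoeff (by simp [hh])

theorem constantCoeff_cpow {h : PowerSeries ℂ} (hh : PowerSeries.constantCoeff h = 1) (t : ℂ) :
    PowerSeries.constantCoeff (cpow h t) = 1 := by
  rw [cpow, constantCoeff_subst_eq (by simp [hh]), PowerSeries.binomialSeries_constantCoeff]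

theorem cpow_add {h : PowerSeries ℂ} (hh : PowerSeries.constantCoeff h = 1) (s t : ℂ) :
    cpow h (s + t) = cpow h s * cpow h t := by
  rw [cpow, PowerSeries.binomialSeries_add, PowerSeries.subst_mul (hasSubst_sub_one hh)]
  rfl

theorem cpow_zero (h : PowerSeries ℂ) : cpow h 0 = 1 := by
  rw [cpow, PowerSeries.binomialSeries_zero, subst_one_eq]

theorem cpow_one {h : PowerSeries ℂ} (hh : PowerSeries.constantCoeff h = 1) : cpow h 1 = h := by
  have h1 := PowerSeries.binomialSeries_nat (R := ℂ) (A := ℂ) 1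
  rw [Nat.cast_one, pow_one] at h1
  rw [cpow, h1, PowerSeries.subst_add (hasSubst_sub_one hh), subst_one_eq,
    PowerSeries.subst_X (hasSubst_sub_one hh)]
  exact add_sub_cancel _ _

theorem subst_cpow {h g : PowerSeries ℂ} (hh : PowerSeries.constantCoeff h = 1)
    (hg : PowerSeries.constantCoeff g = 0) (t : ℂ) :
    PowerSeries.subst g (cpow h t) = cpow (PowerSeries.subst g h) t := by
  rw [cpow, PowerSeries.subst_comp_subst_apply (hasSubst_sub_one hh) (hasSubst_of_constantCoeff hg),
    PowerSeries.subst_sub (hasSubst_of_constantCoeff hg), subst_one_eq]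
  rfl

theorem succ_mul_choose_succ (t : ℂ) (n : ℕ) :
    ((n : ℂ) + 1) * Ring.choose t (n + 1) = (t - n) * Ring.choose t n := by
  have hn : ((n : ℂ) + 1) ≠ 0 := Nat.cast_add_one_ne_zero n
  have hf : (n.factorial : ℂ) ≠ 0 := by exact_mod_cast n.factorial_ne_zero
  rw [Ring.choose_eq_smul, Ring.choose_eq_smul, descPochhammer_succ_right, Polynomial.smeval_mul,
    Nat.factorial_succ]
  simp only [Polynomial.smeval_sub, Polynomial.smeval_X, Polynomial.smeval_natCast, pow_one,
    smul_eq_mul, nsmul_eq_mul, Nat.cast_mul, pow_zero, mul_one]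
  push_cast
  field_simp

/-- Coefficientwise this is `(n+1) binom(t, n+1) = (t-n) binom(t, n)`. -/
theorem derivative_binomialSeries (t : ℂ) :
    (1 + PowerSeries.X) * PowerSeries.derivative ℂ (PowerSeries.binomialSeries ℂ t) =
      PowerSeries.C t * PowerSeries.binomialSeries ℂ t := by
  ext n
  rw [add_mul, one_mul, map_add, PowerSeries.coeff_C_mul, PowerSeries.coeff_derivative]
  cases n with
  | zero =>
    have h := succ_mul_choose_succ t 0
    simp at h ⊢
  | succ n =>
    rw [PowerSeries.coeff_succ_X_mul, PowerSeries.coeff_derivative]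
    have h := succ_mul_choose_succ t (n + 1)
    simp only [PowerSeries.binomialSeries_coeff, smul_eq_mul, mul_one]
    push_cast at h ⊢
    linear_combination h

/-- The chain rule applied to `(1+y) B' = t B`; keeping the factor `h` on the left avoids the power
`t - 1`. -/
theorem derivative_cpow {h : PowerSeries ℂ} (hh : PowerSeries.constantCoeff h = 1) (t : ℂ) :
    h * PowerSeries.derivative ℂ (cpow h t) =
      PowerSeries.C t * PowerSeries.derivative ℂ h * cpow h t := by
  have hs := hasSubst_sub_one hh
  have key := congrArg (PowerSeries.subst (h - 1)) (derivative_binomialSeries t)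
  rw [PowerSeries.subst_mul hs, PowerSeries.subst_mul hs, PowerSeries.subst_add hs, subst_one_eq,
    PowerSeries.subst_X hs, subst_C_eq, add_sub_cancel] at key
  rw [cpow, PowerSeries.derivative_subst hs, map_sub, PowerSeries.derivative_one, sub_zero]
  linear_combination PowerSeries.derivative ℂ h * key

/-! ### The series of the ultraspherical family -/

section Series

variable (a b lam : ℂ)

/-- The polynomial series `1 + λ a y + λ b y ^ 2`, which is `f'` in terms of `f`. -/
noncomputable def quadSeries : PowerSeries ℂ :=
  1 + PowerSeries.C (lam * a) * PowerSeries.X + PowerSeries.C (lam * b) * PowerSeries.X ^ 2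

/-- The series `y / (1 + λ a y + λ b y ^ 2)`, which is `f / f'` in terms of `f`. -/
noncomputable def quotSeries : PowerSeries ℂ :=
  PowerSeries.subst (compInv (baseSeries a b lam)) (frakT (baseSeries a b lam))

theorem constantCoeff_quadSeries : PowerSeries.constantCoeff (quadSeries a b lam) = 1 := by
  simp [quadSeries]

theorem constantCoeff_derivative_baseSeries :
    PowerSeries.constantCoeff (PowerSeries.derivative ℂ (baseSeries a b lam)) = 1 := by
  rw [derivative_baseSeries]
  simp [constantCoeff_baseSeries]

theorem coeff_one_baseSeries : PowerSeries.coeff 1 (baseSeries a b lam) = 1 := by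
  have h := constantCoeff_derivative_baseSeries a b lam
  rw [← PowerSeries.coeff_zero_eq_constantCoeff_apply, PowerSeries.coeff_derivative] at h
  simpa using h

theorem frakT_mul_derivative :
    frakT (baseSeries a b lam) * PowerSeries.derivative ℂ (baseSeries a b lam) =
      baseSeries a b lam := by
  rw [frakT, mul_assoc, PowerSeries.inv_mul_cancel, mul_one]
  rw [constantCoeff_derivative_baseSeries]
  exact one_ne_zero

theorem constantCoeff_frakT : PowerSeries.constantCoeff (frakT (baseSeries a b lam)) = 0 := by
  rw [frakT, map_mul, constantCoeff_baseSeries, zero_mul]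

theorem coeff_one_frakT : PowerSeries.coeff 1 (frakT (baseSeries a b lam)) = 1 := by
  have h := congrArg (PowerSeries.coeff 1) (frakT_mul_derivative a b lam)
  rw [PowerSeries.coeff_one_mul, constantCoeff_frakT, constantCoeff_derivative_baseSeries,
    coeff_one_baseSeries] at h
  simpa using h

theorem constantCoeff_omegaSeries : PowerSeries.constantCoeff (omegaSeries a b lam) = 0 :=
  constantCoeff_compInv _

theorem constantCoeff_quotSeries : PowerSeries.constantCoeff (quotSeries a b lam) = 0 := by
  rw [quotSeries, constantCoeff_subst_eq (constantCoeff_compInv _), constantCoeff_frakT]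

theorem baseSeries_subst_compInv :
    PowerSeries.subst (compInv (baseSeries a b lam)) (baseSeries a b lam) = PowerSeries.X :=
  subst_compInv _ (constantCoeff_baseSeries a b lam) (by simp [coeff_one_baseSeries])

theorem derivative_baseSeries_subst_compInv :
    PowerSeries.subst (compInv (baseSeries a b lam))
      (PowerSeries.derivative ℂ (baseSeries a b lam)) = quadSeries a b lam := by
  have hs := hasSubst_compInv (baseSeries a b lam)
  rw [derivative_baseSeries, PowerSeries.subst_add hs, PowerSeries.subst_add hs, subst_one_eq,
    PowerSeries.subst_mul hs, PowerSeries.subst_mul hs, PowerSeries.subst_pow hs, subst_C_eq,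
    subst_C_eq, baseSeries_subst_compInv, quadSeries]

theorem quotSeries_mul_quadSeries :
    quotSeries a b lam * quadSeries a b lam = PowerSeries.X := by
  have hs := hasSubst_compInv (baseSeries a b lam)
  have h := congrArg (PowerSeries.subst (compInv (baseSeries a b lam)))
    (frakT_mul_derivative a b lam)
  rwa [PowerSeries.subst_mul hs, derivative_baseSeries_subst_compInv,
    baseSeries_subst_compInv] at h

theorem derivative_quotSeries :
    PowerSeries.derivative ℂ (quotSeries a b lam) * quadSeries a b lam +
      quotSeries a b lam * PowerSeries.derivative ℂ (quadSeries a b lam) = 1 := by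
  have h := congrArg (PowerSeries.derivative ℂ) (quotSeries_mul_quadSeries a b lam)
  rw [Derivation.leibniz, PowerSeries.derivative_X, smul_eq_mul, smul_eq_mul] at h
  linear_combination h

theorem derivative_quadSeries :
    PowerSeries.derivative ℂ (quadSeries a b lam) =
      PowerSeries.C lam * (PowerSeries.C a + 2 * PowerSeries.C b * PowerSeries.X) := by
  rw [quadSeries, map_add, map_add, PowerSeries.derivative_one, Derivation.leibniz,
    Derivation.leibniz, PowerSeries.derivative_pow, PowerSeries.derivative_C,
    PowerSeries.derivative_C, PowerSeries.derivative_X, map_mul, map_mul]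
  simp only [smul_eq_mul]
  push_cast
  ring

theorem omegaSeries_subst_frakT :
    PowerSeries.subst (frakT (baseSeries a b lam)) (omegaSeries a b lam) = PowerSeries.X :=
  compInv_subst _ (constantCoeff_frakT a b lam) (by simp [coeff_one_frakT])

theorem omegaSeries_subst_quotSeries :
    PowerSeries.subst (quotSeries a b lam) (omegaSeries a b lam) =
      compInv (baseSeries a b lam) := by
  rw [quotSeries, ← PowerSeries.subst_comp_subst_apply
    (hasSubst_of_constantCoeff (constantCoeff_frakT a b lam)) (hasSubst_compInv _),
    omegaSeries_subst_frakT, PowerSeries.subst_X (hasSubst_compInv _)]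

/-- `ω'(u) u' f'(φ) = 1`, where `φ` is the compositional inverse of `f` and `u = (f / f')(φ)`. -/
theorem derivative_omegaSeries_subst_quotSeries :
    PowerSeries.subst (quotSeries a b lam) (PowerSeries.derivative ℂ (omegaSeries a b lam)) *
      (quadSeries a b lam * PowerSeries.derivative ℂ (quotSeries a b lam)) = 1 := by
  have h1 := congrArg (PowerSeries.derivative ℂ) (omegaSeries_subst_quotSeries a b lam)
  have h2 := congrArg (PowerSeries.derivative ℂ) (baseSeries_subst_compInv a b lam)
  rw [PowerSeries.derivative_subst
    (hasSubst_of_constantCoeff (constantCoeff_quotSeries a b lam))] at h1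
  rw [PowerSeries.derivative_subst (hasSubst_compInv _), derivative_baseSeries_subst_compInv,
    PowerSeries.derivative_X] at h2
  linear_combination quadSeries a b lam * h1 + h2

/-- This is the reason for the shape of `ℓ`: since `ω(u)` is the inverse of `f`, `f'(ω(u))` becomes
`Q`, and the factor `ω'(u)` cancels `Q u'`. -/
theorem ellSeries_subst_quotSeries (c : ℂ) :
    PowerSeries.subst (quotSeries a b lam) (ellSeries a b lam c) *
      (quadSeries a b lam * PowerSeries.derivative ℂ (quotSeries a b lam)) =
        cpow (quadSeries a b lam) (c + 1 / lam - 1) := by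
  have hu := constantCoeff_quotSeries a b lam
  have hω := constantCoeff_omegaSeries a b lam
  have h1 : PowerSeries.constantCoeff (PowerSeries.subst (omegaSeries a b lam)
      (PowerSeries.derivative ℂ (baseSeries a b lam)) : PowerSeries ℂ) = 1 := by
    rw [constantCoeff_subst_eq hω, constantCoeff_derivative_baseSeries]
  rw [ellSeries, PowerSeries.subst_mul (hasSubst_of_constantCoeff hu), subst_cpow h1 hu,
    PowerSeries.subst_comp_subst_apply (hasSubst_of_constantCoeff hω)
      (hasSubst_of_constantCoeff hu), omegaSeries_subst_quotSeries,
    derivative_baseSeries_subst_compInv]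
  linear_combination cpow (quadSeries a b lam) (c + 1 / lam - 1) *
    derivative_omegaSeries_subst_quotSeries a b lam

theorem constantCoeff_ellSeries (c : ℂ) :
    PowerSeries.constantCoeff (ellSeries a b lam c) = 1 := by
  have h := congrArg PowerSeries.constantCoeff (ellSeries_subst_quotSeries a b lam c)
  have h' := congrArg PowerSeries.constantCoeff (derivative_quotSeries a b lam)
  rw [map_add, map_mul, map_mul, constantCoeff_quotSeries, constantCoeff_quadSeries, map_one,
    mul_one, zero_mul, add_zero] at h'
  rwa [map_mul, map_mul, constantCoeff_subst_eq (constantCoeff_quotSeries a b lam), h',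
    constantCoeff_quadSeries, mul_one, mul_one,
    constantCoeff_cpow (constantCoeff_quadSeries a b lam)] at h

end Series

/-! ### The diagonal sequences -/

section Sequences

variable {lam c : ℂ}

theorem gamma_argument_ne_zero (hlam : lam ≠ 0) (hF : ∀ n : ℕ, 1 + lam * (n + c) ≠ 0) (n : ℕ) :
    c + n + 1 / lam ≠ 0 := by
  intro h
  refine hF n ?_
  field_simp at h
  linear_combination h

theorem gamma_ne_zero (hlam : lam ≠ 0) (hF : ∀ n : ℕ, 1 + lam * (n + c) ≠ 0) (n : ℕ) :
    Complex.Gamma (c + n + 1 / lam) ≠ 0 := by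
  -- A pole `-m` of the argument at index `n` would make the argument at index `n + m` zero.
  refine Complex.Gamma_ne_zero fun m h => gamma_argument_ne_zero hlam hF (n + m) ?_
  push_cast
  linear_combination h

theorem seqF_zero (hlam : lam ≠ 0) (hF : ∀ n : ℕ, 1 + lam * (n + c) ≠ 0) : seqF lam c 0 = 1 := by
  have h := gamma_ne_zero hlam hF 0
  rw [Nat.cast_zero, add_zero] at h
  simp only [seqF, pow_zero, inv_one, one_mul, Nat.cast_zero, add_zero]
  exact div_self h

theorem seqF_ne_zero (hlam : lam ≠ 0) (hF : ∀ n : ℕ, 1 + lam * (n + c) ≠ 0) (n : ℕ) :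
    seqF lam c n ≠ 0 := by
  have h := gamma_ne_zero hlam hF 0
  rw [Nat.cast_zero, add_zero] at h
  exact mul_ne_zero (inv_ne_zero (pow_ne_zero _ hlam)) (div_ne_zero h (gamma_ne_zero hlam hF n))

/-- `Γ(z+1) = z Γ(z)` at `z = c + n + 1/λ`, where `λ z = 1 + λ(n+c)`. -/
theorem seqF_succ (hlam : lam ≠ 0) (hF : ∀ n : ℕ, 1 + lam * (n + c) ≠ 0) (n : ℕ) :
    seqF lam c (n + 1) * (1 + lam * (n + c)) = seqF lam c n := by
  have hz := gamma_argument_ne_zero hlam hF n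
  have hg := gamma_ne_zero hlam hF n
  have h1 : Complex.Gamma (c + (n + 1 : ℕ) + 1 / lam) =
      (c + n + 1 / lam) * Complex.Gamma (c + n + 1 / lam) := by
    rw [← Complex.Gamma_add_one _ hz]
    congr 1
    push_cast
    ring
  have h2 : 1 + lam * (n + c) = lam * (c + n + 1 / lam) := by
    field_simp
    ring
  rw [seqF, seqF, h1, h2]
  generalize c + n + 1 / lam = z at *
  generalize Complex.Gamma (c + 1 / lam) = w
  field_simp
  ring

theorem seqFall_zero (c : ℂ) : seqFall c 0 = 1 := by simp [seqFall]

theorem seqFall_succ (c : ℂ) (n : ℕ) : seqFall c (n + 1) = (n + 1 + c) * seqFall c n := by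
  rw [seqFall, seqFall, descPochhammer_succ_left, Polynomial.eval_mul, Polynomial.eval_X,
    Polynomial.eval_comp, Polynomial.eval_sub, Polynomial.eval_X, Polynomial.eval_one]
  push_cast
  rw [show c + (n + 1) - 1 = c + (n : ℂ) by ring]
  ring

theorem seqFall_ne_zero (hc : ∀ n : ℕ, c + n + 1 ≠ 0) (n : ℕ) : seqFall c n ≠ 0 := by
  induction n with
  | zero => simp [seqFall_zero]
  | succ n ih =>
    rw [seqFall_succ]
    refine mul_ne_zero ?_ ih
    rw [show (n : ℂ) + 1 + c = c + n + 1 by ring]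
    exact hc n

theorem seqH_zero (c : ℂ) : seqH c 0 = 1 := by simp [seqH]

/-- Both sides are `(c+n)_{n+1}`, with the largest or the smallest factor split off. This is what
determines `H`. -/
theorem add_mul_seqH (c : ℂ) (n : ℕ) : (c + n) * seqH c n = c * seqFall c n := by
  have h := descPochhammer_succ_eval n (c + n)
  rw [descPochhammer_succ_left, Polynomial.eval_mul, Polynomial.eval_X, Polynomial.eval_comp,
    Polynomial.eval_sub, Polynomial.eval_X, Polynomial.eval_one] at h
  rw [seqH, seqFall, h]
  ring

end Sequences

/-! ### The transpose of `G_Q(c)` -/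

section Transpose

variable (a b lam c : ℂ)

/-- The image of `ℓ` under the transpose of
`θ! (H_θ F_θ · ℓ)(D) (c+θ)_θ⁻¹ F_θ⁻¹`. -/
noncomputable def innerSeries (l : PowerSeries ℂ) : PowerSeries ℂ :=
  diagSeries (fun n => (seqF lam c n)⁻¹) <| diagSeries (fun n => (seqFall c n)⁻¹) <|
    diagSeries (fun n => seqH c n * seqF lam c n) (ellSeries a b lam c) *
      diagSeries (fun n => (n.factorial : ℂ)) l

/-- The image of `ℓ` under the transpose of
`θ! (H_θ F_θ · ℓ)(D) (c+θ)_θ⁻¹ F_θ⁻¹ C_{f/f'}⁻¹ f'(D)^(-c-1/λ) C_f`. -/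
noncomputable def outerSeries (l : PowerSeries ℂ) : PowerSeries ℂ :=
  cpow (quadSeries a b lam) (-c - 1 / lam) *
    PowerSeries.subst (quotSeries a b lam) (innerSeries a b lam c l)

variable {a b lam c}

theorem factorial_cast_ne_zero (n : ℕ) : (n.factorial : ℂ) ≠ 0 := by
  exact_mod_cast n.factorial_ne_zero

/-- `H_n` may vanish, for instance when `c = 0` and `n > 0`, but it only weights a series in `D`,
whose invertibility depends on the constant term `H_0 F_0 ℓ_0 = 1`. -/
theorem isUnit_opG (hlam : lam ≠ 0) (hc : ∀ n : ℕ, c + n + 1 ≠ 0)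
    (hF : ∀ n : ℕ, 1 + lam * (n + c) ≠ 0) : IsUnit (opG a b lam c) := by
  have h1 : IsUnit (ofD (diagSeries (fun n => seqH c n * seqF lam c n)
      (ellSeries a b lam c))) := by
    refine isUnit_ofD ?_
    rw [← PowerSeries.coeff_zero_eq_constantCoeff_apply, diagSeries, PowerSeries.coeff_mk,
      PowerSeries.coeff_zero_eq_constantCoeff_apply, constantCoeff_ellSeries, seqH_zero,
      seqF_zero hlam hF]
    simp
  have h2 : IsUnit (ofD (cpow (PowerSeries.derivative ℂ (baseSeries a b lam))
      (-c - 1 / lam))) := by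
    refine isUnit_ofD ?_
    rw [constantCoeff_cpow (constantCoeff_derivative_baseSeries a b lam)]
    exact one_ne_zero
  have h3 := isUnit_diag (seqF_ne_zero hlam hF)
  have h4 := isUnit_diag (seqFall_ne_zero hc)
  have h5 := isUnit_diag factorial_cast_ne_zero
  have h6 : IsUnit (umbral (baseSeries a b lam)) :=
    isUnit_umbral (constantCoeff_baseSeries a b lam) (by simp [coeff_one_baseSeries])
  have h7 : IsUnit (umbral (frakT (baseSeries a b lam))) :=
    isUnit_umbral (constantCoeff_frakT a b lam) (by simp [coeff_one_frakT])
  exact (((((((((h5.mul h1).mul h4.ringInverse).mul h3.ringInverse).mul h7.ringInverse).mul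
    h2).mul h6).mul h3).mul h4).mul h5.ringInverse)

/-- Transposition reverses the product, so the factors act on `l` from left to right; the final
`1/θ!` cancels the `n!` of the pairing. -/
theorem pairing_opG (hlam : lam ≠ 0) (hc : ∀ n : ℕ, c + n + 1 ≠ 0)
    (hF : ∀ n : ℕ, 1 + lam * (n + c) ≠ 0) (l : PowerSeries ℂ) (n : ℕ) :
    pairing l (opG a b lam c (X ^ n)) =
      seqF lam c n * seqFall c n * PowerSeries.coeff n (outerSeries a b lam c l) := by
  have hφ := hasSubst_compInv (baseSeries a b lam)
  have hg0 := constantCoeff_frakT a b lam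
  have hg1 : PowerSeries.coeff 1 (frakT (baseSeries a b lam)) ≠ 0 := by simp [coeff_one_frakT]
  have hout : PowerSeries.subst (compInv (baseSeries a b lam))
      (cpow (PowerSeries.derivative ℂ (baseSeries a b lam)) (-c - 1 / lam) *
        PowerSeries.subst (frakT (baseSeries a b lam)) (innerSeries a b lam c l)) =
      outerSeries a b lam c l := by
    rw [PowerSeries.subst_mul hφ, subst_cpow (constantCoeff_derivative_baseSeries a b lam)
      (constantCoeff_compInv _), derivative_baseSeries_subst_compInv,
      PowerSeries.subst_comp_subst_apply (hasSubst_of_constantCoeff hg0) hφ]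
    rfl
  simp only [opG, Module.End.mul_apply, inverse_diag factorial_cast_ne_zero,
    inverse_diag (seqF_ne_zero hlam hF), inverse_diag (seqFall_ne_zero hc),
    inverse_umbral hg0 hg1, pairing_diag, pairing_ofD, pairing_umbral, compInv_compInv _ hg0 hg1]
  rw [← innerSeries, hout, pairing_X_pow]
  simp only [diagSeries, PowerSeries.coeff_mk]
  have := factorial_cast_ne_zero n
  field_simp

/-! ### The differential equations for the transposed series. -/

theorem coeff_X_mul_derivative (n : ℕ) (s : PowerSeries ℂ) :
    PowerSeries.coeff n (PowerSeries.X * PowerSeries.derivative ℂ s) =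
      n * PowerSeries.coeff n s := by
  cases n with
  | zero => simp
  | succ n =>
    rw [PowerSeries.coeff_succ_X_mul, PowerSeries.coeff_derivative]
    push_cast
    ring

/-- Passing from `l'` to `l` shifts the series by one degree, up to the constant term. Dividing by
`F_n (c+n)_n` turns the shift into the ratio `(1+λ(n+c)) / (n+1+c)`, and the contribution of `l(0)`
into a multiple of `ℓ`. -/
theorem innerSeries_equation (hlam : lam ≠ 0) (hc : ∀ n : ℕ, c + n + 1 ≠ 0)
    (hF : ∀ n : ℕ, 1 + lam * (n + c) ≠ 0) (l : PowerSeries ℂ) :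
    PowerSeries.C c * innerSeries a b lam c l +
        PowerSeries.X * PowerSeries.derivative ℂ (innerSeries a b lam c l) -
      PowerSeries.X * (PowerSeries.C (1 + lam * c) *
          innerSeries a b lam c (PowerSeries.derivative ℂ l) +
        PowerSeries.C lam * (PowerSeries.X *
          PowerSeries.derivative ℂ (innerSeries a b lam c (PowerSeries.derivative ℂ l)))) =
      PowerSeries.C (PowerSeries.constantCoeff l * c) * ellSeries a b lam c := by
  set M := diagSeries (fun n => seqH c n * seqF lam c n) (ellSeries a b lam c) with hM
  -- Here `(n+1)! l_{n+1} = n! (l')_n`.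
  have hshift : diagSeries (fun n => (n.factorial : ℂ)) l =
      PowerSeries.C (PowerSeries.constantCoeff l) + PowerSeries.X *
        diagSeries (fun n => (n.factorial : ℂ)) (PowerSeries.derivative ℂ l) := by
    ext n
    cases n with
    | zero => simp [diagSeries]
    | succ n =>
      rw [map_add, PowerSeries.coeff_succ_X_mul, PowerSeries.coeff_C, if_neg n.succ_ne_zero,
        zero_add, diagSeries, diagSeries, PowerSeries.coeff_mk, PowerSeries.coeff_mk,
        PowerSeries.coeff_derivative, Nat.factorial_succ]
      push_cast
      ring
  have hprod : M * diagSeries (fun n => (n.factorial : ℂ)) l =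
      PowerSeries.C (PowerSeries.constantCoeff l) * M + PowerSeries.X *
        (M * diagSeries (fun n => (n.factorial : ℂ)) (PowerSeries.derivative ℂ l)) := by
    rw [hshift]
    ring
  have hr : ∀ (s : PowerSeries ℂ) (n : ℕ), PowerSeries.coeff n (innerSeries a b lam c s) =
      (seqF lam c n)⁻¹ * ((seqFall c n)⁻¹ *
        PowerSeries.coeff n (M * diagSeries (fun n => (n.factorial : ℂ)) s)) := by
    intro s n
    rw [innerSeries, diagSeries, PowerSeries.coeff_mk, diagSeries, PowerSeries.coeff_mk]
  -- The weights `H_n F_n` cancel against `F_n (c+n)_n` once multiplied by `c + n`, leaving exactly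
  -- `c ℓ_n`.
  have hMn : ∀ n : ℕ, (c + n) * ((seqF lam c n)⁻¹ * ((seqFall c n)⁻¹ *
      PowerSeries.coeff n M)) = c * PowerSeries.coeff n (ellSeries a b lam c) := by
    intro n
    have h1 := seqF_ne_zero hlam hF n
    have h2 := seqFall_ne_zero hc n
    rw [hM, diagSeries, PowerSeries.coeff_mk]
    field_simp
    linear_combination PowerSeries.coeff n (ellSeries a b lam c) * add_mul_seqH c n
  generalize hk : 1 + lam * c = k
  ext n
  cases n with
  | zero =>
    have h := hMn 0
    have hp := congrArg PowerSeries.constantCoeff hprod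
    simp only [map_add, map_mul, PowerSeries.constantCoeff_X, zero_mul, add_zero,
      PowerSeries.constantCoeff_C] at hp
    have hr0 := hr l 0
    simp only [PowerSeries.coeff_zero_eq_constantCoeff, map_mul, hp, Nat.cast_zero,
      add_zero] at hr0 h
    simp only [PowerSeries.coeff_zero_eq_constantCoeff, map_sub, map_add, map_mul,
      PowerSeries.constantCoeff_X, PowerSeries.constantCoeff_C, zero_mul, add_zero, sub_zero, hr0]
    linear_combination PowerSeries.constantCoeff l * h
  | succ n =>
    have h := hMn (n + 1)
    have hp := congrArg (PowerSeries.coeff (n + 1)) hprod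
    rw [map_add, PowerSeries.coeff_C_mul, PowerSeries.coeff_succ_X_mul] at hp
    simp only [map_sub, map_add, PowerSeries.coeff_C_mul, PowerSeries.coeff_succ_X_mul,
      PowerSeries.coeff_derivative, coeff_X_mul_derivative]
    rw [hr l, hr (PowerSeries.derivative ℂ l), hp, ← seqF_succ hlam hF n, ← hk]
    have h1 := seqF_ne_zero hlam hF (n + 1)
    have h2 := seqFall_ne_zero hc n
    have h3 := hF n
    have h4 := seqFall_succ c n
    have h5 := seqFall_ne_zero hc (n + 1)
    have h6 : (n : ℂ) + 1 + c ≠ 0 := by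
      rw [h4] at h5
      exact left_ne_zero_of_mul h5
    push_cast at h ⊢
    rw [h4] at h ⊢
    field_simp at h ⊢
    linear_combination PowerSeries.constantCoeff l * (1 + lam * (n + c)) * h

/-- The change of variable as pure algebra. Here `A = Q^(-s)`, `s = c + 1/λ`, `B = Q^(s-1)`, `L =
λ`, `L' = 1/λ`; `r, d` and `r₂, d₂` are the inner series and their derivatives at `u`, and `e` is
`ℓ(u)`. After multiplying `hr` by `A Q (Q u')` and using `Q u' = 1 - u Q'`, the leftover terms in
`Q'` cancel because `s = c + 1/λ` and `λ s = 1 + λ c`. -/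
theorem substituted_equation {R : Type*} [CommRing R]
    {c s L L' a b Q Q' u u' A A' B X r d r₂ d₂ l₀ e : R} (hX : u * Q = X)
    (hu : u' * Q + u * Q' = 1) (hA : Q * A' = -s * Q' * A) (hL : L' * L = 1) (hs : s = c + L')
    (hQ' : Q' = L * (a + 2 * b * X)) (hAB : A * B * Q = 1) (he : e * (Q * u') = B)
    (hr : c * r + u * d - u * ((1 + L * c) * r₂ + L * (u * d₂)) = l₀ * c * e) :
    Q * (c * (A * r) + X * (A' * r + A * (d * u'))) + (a * X + 2 * b * X ^ 2) * (A * r) -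
      X * ((1 + L * c) * (A * r₂) + L * (X * (A' * r₂ + A * (d₂ * u')))) = l₀ * c := by
  -- The extra quadratic term is `y Q' / λ`, the part of the exponent `s` not absorbed by `c`.
  have hq : a * X + 2 * b * X ^ 2 = X * (L' * Q') := by
    linear_combination -X * L' * hQ' - (a * X + 2 * b * X ^ 2) * hL
  rw [hq]
  subst hX hs
  linear_combination (u * Q * r - u * Q * L * u * r₂) * hA - c * A * Q * r * hu +
    u * Q * (1 + L * c) * A * r₂ * hu + A * Q * (Q * u') * hr + A * Q * l₀ * c * he + l₀ * c * hAB +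
    u * Q * u * Q' * A * r₂ * hL

theorem innerSeries_equation_subst (hlam : lam ≠ 0) (hc : ∀ n : ℕ, c + n + 1 ≠ 0)
    (hF : ∀ n : ℕ, 1 + lam * (n + c) ≠ 0) (l : PowerSeries ℂ) {g : PowerSeries ℂ}
    (hg : PowerSeries.HasSubst g) {r d r₂ d₂ e : PowerSeries ℂ}
    (hr : r = PowerSeries.subst g (innerSeries a b lam c l))
    (hd : d = PowerSeries.subst g (PowerSeries.derivative ℂ (innerSeries a b lam c l)))
    (hr₂ : r₂ = PowerSeries.subst g (innerSeries a b lam c (PowerSeries.derivative ℂ l)))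
    (hd₂ : d₂ = PowerSeries.subst g
      (PowerSeries.derivative ℂ (innerSeries a b lam c (PowerSeries.derivative ℂ l))))
    (he : e = PowerSeries.subst g (ellSeries a b lam c)) :
    PowerSeries.C c * r + g * d -
        g * ((1 + PowerSeries.C lam * PowerSeries.C c) * r₂ + PowerSeries.C lam * (g * d₂)) =
      PowerSeries.C (PowerSeries.constantCoeff l) * PowerSeries.C c * e := by
  have h := congrArg (PowerSeries.substAlgHom hg)
    (innerSeries_equation (a := a) (b := b) hlam hc hF l)
  have hC : ∀ z : ℂ, PowerSeries.substAlgHom hg (PowerSeries.C z) =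
      (PowerSeries.C z : PowerSeries ℂ) := fun z => by
    rw [PowerSeries.coe_substAlgHom]
    exact subst_C_eq g z
  have hX : PowerSeries.substAlgHom hg (PowerSeries.X : PowerSeries ℂ) = g := by
    rw [PowerSeries.coe_substAlgHom]
    exact PowerSeries.subst_X hg
  rw [← PowerSeries.coe_substAlgHom hg] at hr hd hr₂ hd₂ he
  simp only [map_add, map_sub, map_mul, map_one, hC, hX, ← hr, ← hd, ← hr₂, ← hd₂, ← he] at h
  exact h

theorem outerSeries_equation (hlam : lam ≠ 0) (hc : ∀ n : ℕ, c + n + 1 ≠ 0)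
    (hF : ∀ n : ℕ, 1 + lam * (n + c) ≠ 0) (l : PowerSeries ℂ) :
    quadSeries a b lam * (PowerSeries.C c * outerSeries a b lam c l +
        PowerSeries.X * PowerSeries.derivative ℂ (outerSeries a b lam c l)) +
      (PowerSeries.C a * PowerSeries.X + 2 * PowerSeries.C b * PowerSeries.X ^ 2) *
        outerSeries a b lam c l -
      PowerSeries.X * ((1 + PowerSeries.C lam * PowerSeries.C c) *
          outerSeries a b lam c (PowerSeries.derivative ℂ l) +
        PowerSeries.C lam * (PowerSeries.X *
          PowerSeries.derivative ℂ (outerSeries a b lam c (PowerSeries.derivative ℂ l)))) =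
      PowerSeries.C (PowerSeries.constantCoeff l) * PowerSeries.C c := by
  have hQ := constantCoeff_quadSeries a b lam
  have hs := hasSubst_of_constantCoeff (constantCoeff_quotSeries a b lam)
  have hd : ∀ s, PowerSeries.derivative ℂ (outerSeries a b lam c s) =
      PowerSeries.derivative ℂ (cpow (quadSeries a b lam) (-c - 1 / lam)) *
          PowerSeries.subst (quotSeries a b lam) (innerSeries a b lam c s) +
        cpow (quadSeries a b lam) (-c - 1 / lam) *
          (PowerSeries.subst (quotSeries a b lam)
            (PowerSeries.derivative ℂ (innerSeries a b lam c s)) *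
            PowerSeries.derivative ℂ (quotSeries a b lam)) := by
    intro s
    rw [outerSeries, Derivation.leibniz, PowerSeries.derivative_subst hs, smul_eq_mul, smul_eq_mul]
    ring
  rw [hd, hd, outerSeries, outerSeries]
  have hA : quadSeries a b lam *
      PowerSeries.derivative ℂ (cpow (quadSeries a b lam) (-c - 1 / lam)) =
      -PowerSeries.C (c + 1 / lam) * PowerSeries.derivative ℂ (quadSeries a b lam) *
        cpow (quadSeries a b lam) (-c - 1 / lam) := by
    rw [derivative_cpow hQ, ← map_neg, neg_add']
  have hL : (PowerSeries.C (1 / lam) : PowerSeries ℂ) * PowerSeries.C lam = 1 := by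
    rw [← map_mul, one_div_mul_cancel hlam, map_one]
  have hAB : cpow (quadSeries a b lam) (-c - 1 / lam) *
      cpow (quadSeries a b lam) (c + 1 / lam - 1) * quadSeries a b lam = 1 := by
    have h := cpow_add hQ (-c - 1 / lam + (c + 1 / lam - 1)) 1
    rwa [cpow_add hQ (-c - 1 / lam), cpow_one hQ,
      show -c - 1 / lam + (c + 1 / lam - 1) + 1 = 0 by ring, cpow_zero, eq_comm] at h
  exact substituted_equation (quotSeries_mul_quadSeries a b lam) (derivative_quotSeries a b lam) hA
    hL (map_add _ _ _) (derivative_quadSeries a b lam) hAB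
    (ellSeries_subst_quotSeries a b lam c)
    (innerSeries_equation_subst hlam hc hF l hs rfl rfl rfl rfl rfl)

theorem outerSeries_equation_expanded (hlam : lam ≠ 0) (hc : ∀ n : ℕ, c + n + 1 ≠ 0)
    (hF : ∀ n : ℕ, 1 + lam * (n + c) ≠ 0) (l : PowerSeries ℂ) :
    PowerSeries.C c * outerSeries a b lam c l +
        PowerSeries.X * PowerSeries.derivative ℂ (outerSeries a b lam c l) +
      PowerSeries.X * (PowerSeries.C (a * (1 + lam * c)) * outerSeries a b lam c l +
        PowerSeries.C (lam * a) *
          (PowerSeries.X * PowerSeries.derivative ℂ (outerSeries a b lam c l))) +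
      PowerSeries.X * (PowerSeries.X * (PowerSeries.C (b * (2 + lam * c)) *
          outerSeries a b lam c l + PowerSeries.C (lam * b) *
          (PowerSeries.X * PowerSeries.derivative ℂ (outerSeries a b lam c l)))) =
      PowerSeries.C (PowerSeries.constantCoeff l * c) +
      PowerSeries.X * (PowerSeries.C (1 + lam * c) *
          outerSeries a b lam c (PowerSeries.derivative ℂ l) +
        PowerSeries.C lam * (PowerSeries.X *
          PowerSeries.derivative ℂ (outerSeries a b lam c (PowerSeries.derivative ℂ l)))) := by
  have h := outerSeries_equation (a := a) (b := b) hlam hc hF l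
  have h2 : (PowerSeries.C (2 : ℂ) : PowerSeries ℂ) = 2 := map_ofNat _ 2
  rw [quadSeries] at h
  simp only [map_mul, map_add, map_one, h2] at h ⊢
  linear_combination h

theorem outerSeries_derivative_coeff_zero (hlam : lam ≠ 0) (hc : ∀ n : ℕ, c + n + 1 ≠ 0)
    (hF : ∀ n : ℕ, 1 + lam * (n + c) ≠ 0) (l : PowerSeries ℂ) :
    (1 + lam * c) * PowerSeries.coeff 0 (outerSeries a b lam c (PowerSeries.derivative ℂ l)) =
      (1 + c) * PowerSeries.coeff 1 (outerSeries a b lam c l) +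
        a * (1 + lam * c) * PowerSeries.coeff 0 (outerSeries a b lam c l) := by
  have h := congrArg (PowerSeries.coeff (0 + 1))
    (outerSeries_equation_expanded (a := a) (b := b) hlam hc hF l)
  generalize hk : 1 + lam * c = k at h ⊢
  simp only [map_add, PowerSeries.coeff_succ_X_mul, PowerSeries.coeff_C_mul,
    PowerSeries.coeff_derivative, PowerSeries.coeff_C, PowerSeries.coeff_zero_X_mul,
    Nat.cast_zero, one_ne_zero, if_false, zero_add] at h
  linear_combination -h

/-- The inhomogeneous term lives in degree `0`, so it disappears in degree `n + 2`. The coefficient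
`2 + λ(n+c)` combines `λ b` from `Q` with the added `2 b y²`. -/
theorem outerSeries_derivative_coeff_succ (hlam : lam ≠ 0) (hc : ∀ n : ℕ, c + n + 1 ≠ 0)
    (hF : ∀ n : ℕ, 1 + lam * (n + c) ≠ 0) (l : PowerSeries ℂ) (n : ℕ) :
    (1 + lam * (n + 1 + c)) *
        PowerSeries.coeff (n + 1) (outerSeries a b lam c (PowerSeries.derivative ℂ l)) =
      (n + 2 + c) * PowerSeries.coeff (n + 2) (outerSeries a b lam c l) +
        a * (1 + lam * (n + 1 + c)) * PowerSeries.coeff (n + 1) (outerSeries a b lam c l) +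
        b * (2 + lam * (n + c)) * PowerSeries.coeff n (outerSeries a b lam c l) := by
  have h := congrArg (PowerSeries.coeff (n + 2))
    (outerSeries_equation_expanded (a := a) (b := b) hlam hc hF l)
  rw [show n + 2 = n + 1 + 1 from rfl] at h ⊢
  generalize hk : 1 + lam * c = k at h
  simp only [map_add, PowerSeries.coeff_succ_X_mul, PowerSeries.coeff_C_mul, coeff_X_mul_derivative,
    PowerSeries.coeff_derivative, PowerSeries.coeff_C, Nat.succ_ne_zero, if_false] at h
  rw [← hk] at h
  push_cast at h
  linear_combination -h

/-! ### The recurrence -/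

/-- The degree-`0` part of the differential equation carries a factor `c` and says nothing when `c =
0`; instead the normalizations of all the factors are multiplied out. -/
theorem opG_one (hlam : lam ≠ 0) (hc : ∀ n : ℕ, c + n + 1 ≠ 0)
    (hF : ∀ n : ℕ, 1 + lam * (n + c) ≠ 0) : opG a b lam c 1 = 1 := by
  refine pairing_ext fun l => ?_
  have h := pairing_opG (a := a) (b := b) hlam hc hF l 0
  have h' := pairing_X_pow l 0
  rw [pow_zero] at h h'
  rw [h, h', seqF_zero hlam hF, seqFall_zero, PowerSeries.coeff_zero_eq_constantCoeff_apply,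
    outerSeries, map_mul, constantCoeff_subst_eq (constantCoeff_quotSeries a b lam),
    constantCoeff_cpow (constantCoeff_quadSeries a b lam),
    ← PowerSeries.coeff_zero_eq_constantCoeff_apply, innerSeries, diagSeries, PowerSeries.coeff_mk,
    diagSeries, PowerSeries.coeff_mk, seqF_zero hlam hF, seqFall_zero,
    PowerSeries.coeff_zero_eq_constantCoeff_apply, map_mul,
    ← PowerSeries.coeff_zero_eq_constantCoeff_apply,
    ← PowerSeries.coeff_zero_eq_constantCoeff_apply, diagSeries, PowerSeries.coeff_mk, diagSeries,
    PowerSeries.coeff_mk, seqH_zero, seqF_zero hlam hF,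
    PowerSeries.coeff_zero_eq_constantCoeff_apply, constantCoeff_ellSeries]
  simp

theorem opG_X (hlam : lam ≠ 0) (hc : ∀ n : ℕ, c + n + 1 ≠ 0)
    (hF : ∀ n : ℕ, 1 + lam * (n + c) ≠ 0) : opG a b lam c (X ^ 1) = X - C a := by
  have key : mulX (opG a b lam c (X ^ 0)) =
      opG a b lam c (X ^ 1) + a • opG a b lam c (X ^ 0) := by
    refine pairing_ext fun l => ?_
    have h1 := outerSeries_derivative_coeff_zero (a := a) (b := b) hlam hc hF l
    have h2 := seqF_succ hlam hF 0
    rw [pairing_mulX, map_add, map_smul, pairing_opG hlam hc hF, pairing_opG hlam hc hF,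
      pairing_opG hlam hc hF, seqFall_succ, ← h2, seqFall_zero]
    simp only [Nat.cast_zero, zero_add, smul_eq_mul] at h1 h2 ⊢
    linear_combination seqF lam c 1 * h1
  rw [pow_zero, opG_one hlam hc hF, mulX, LinearMap.mulLeft_apply, mul_one,
    Polynomial.smul_eq_C_mul, mul_one] at key
  linear_combination -key

theorem opG_X_pow_add_two (hlam : lam ≠ 0) (hc : ∀ n : ℕ, c + n + 1 ≠ 0)
    (hF : ∀ n : ℕ, 1 + lam * (n + c) ≠ 0) (n : ℕ) :
    opG a b lam c (X ^ (n + 2)) = (X - C a) * opG a b lam c (X ^ (n + 1)) -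
      C ((n + 1 + c) * ultraB b lam (n + 1 + c)) * opG a b lam c (X ^ n) := by
  have key : mulX (opG a b lam c (X ^ (n + 1))) =
      opG a b lam c (X ^ (n + 2)) + a • opG a b lam c (X ^ (n + 1)) +
        ((n + 1 + c) * ultraB b lam (n + 1 + c)) • opG a b lam c (X ^ n) := by
    refine pairing_ext fun l => ?_
    have h1 := outerSeries_derivative_coeff_succ (a := a) (b := b) hlam hc hF l n
    have h2 := seqF_succ hlam hF n
    have h3 := seqF_succ hlam hF (n + 1)
    have h4 := hF n
    have h5 := hF (n + 1)
    rw [pairing_mulX, map_add, map_add, map_smul, map_smul, pairing_opG hlam hc hF,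
      pairing_opG hlam hc hF, pairing_opG hlam hc hF, pairing_opG hlam hc hF, seqFall_succ c (n + 1),
      seqFall_succ c n, ← h2, ← h3, ultraB, show (n : ℂ) + 1 + c - 1 = n + c by ring]
    push_cast at h1 h5 ⊢
    simp only [smul_eq_mul]
    -- The two factors cleared here are `F_n / F_{n+1}` and `F_{n+1} / F_{n+2}`, so the denominator
    -- of `b_θ` comes from rescaling by `F`.
    have h6 : ((n : ℂ) + 1 + c) * (b * (2 + lam * (n + c)) /
        ((1 + lam * (n + c)) * (1 + lam * (n + 1 + c)))) *
        ((1 + lam * (n + 1 + c)) * (1 + lam * (n + c))) =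
        (n + 1 + c) * (b * (2 + lam * (n + c))) := by
      generalize 1 + lam * ((n : ℂ) + 1 + c) = z at h5 ⊢
      field_simp
    linear_combination seqF lam c (n + 2) * ((n + 1 + c) * seqFall c n) * h1 -
      seqF lam c (n + 2) * seqFall c n * PowerSeries.coeff n (outerSeries a b lam c l) * h6
  rw [mulX, LinearMap.mulLeft_apply, Polynomial.smul_eq_C_mul, Polynomial.smul_eq_C_mul] at key
  linear_combination -key

theorem opG_X_pow (hlam : lam ≠ 0) (hc : ∀ n : ℕ, c + n + 1 ≠ 0)
    (hF : ∀ n : ℕ, 1 + lam * (n + c) ≠ 0) :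
    ∀ n : ℕ, opG a b lam c (X ^ n) = assocPoly (ultraA a) (ultraB b lam) c n
  | 0 => by rw [pow_zero, opG_one hlam hc hF, assocPoly]
  | 1 => by rw [opG_X hlam hc hF, assocPoly, ultraA]
  | n + 2 => by
    rw [opG_X_pow_add_two hlam hc hF, opG_X_pow hlam hc hF (n + 1), opG_X_pow hlam hc hF n,
      assocPoly, ultraA]

/-! ### The dual raising operator. -/

theorem D_X_pow (n : ℕ) : D (X ^ n : ℂ[X]) = (n : ℂ) • X ^ (n - 1) := by
  have h := D_pow_X_pow 1 n
  rwa [pow_one, Nat.descFactorial_one] at h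

theorem mulX_X_pow (n : ℕ) : mulX (X ^ n : ℂ[X]) = X ^ (n + 1) := by
  rw [mulX, LinearMap.mulLeft_apply, pow_succ']

theorem assocRaising_X_pow_zero (A B : ℂ → ℂ) (c : ℂ) :
    assocRaising A B c (X ^ 0) = X ^ 1 + A c • X ^ 0 := by
  simp only [assocRaising, LinearMap.add_apply, Module.End.mul_apply, D_X_pow, mulX_X_pow,
    diag_X_pow, map_smul]
  simp

theorem assocRaising_X_pow_succ (A B : ℂ → ℂ) (c : ℂ) (n : ℕ) :
    assocRaising A B c (X ^ (n + 1)) =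
      X ^ (n + 2) + A (n + 1 + c) • X ^ (n + 1) + ((n + 1 + c) * B (n + 1 + c)) • X ^ n := by
  simp only [assocRaising, LinearMap.add_apply, Module.End.mul_apply, D_X_pow, mulX_X_pow,
    diag_X_pow, map_smul, smul_smul, Nat.add_sub_cancel]
  have hn : (1 + n : ℂ) ≠ 0 := by
    rw [add_comm]
    exact Nat.cast_add_one_ne_zero n
  congr 2
  · push_cast
    rfl
  · rw [show (n : ℂ) + c + 1 = n + 1 + c by ring]
    push_cast
    field_simp
    ring

/-- On monomials this is the three-term recurrence solved for `x p_n`. -/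
theorem mulX_mul_opG (hlam : lam ≠ 0) (hc : ∀ n : ℕ, c + n + 1 ≠ 0)
    (hF : ∀ n : ℕ, 1 + lam * (n + c) ≠ 0) :
    mulX * opG a b lam c = opG a b lam c * assocRaising (ultraA a) (ultraB b lam) c := by
  refine linearMap_ext_X_pow fun n => ?_
  rw [Module.End.mul_apply, Module.End.mul_apply, mulX, LinearMap.mulLeft_apply]
  cases n with
  | zero =>
    rw [assocRaising_X_pow_zero, map_add, map_smul, opG_X hlam hc hF, pow_zero,
      opG_one hlam hc hF, Polynomial.smul_eq_C_mul, ultraA]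
    ring
  | succ n =>
    rw [assocRaising_X_pow_succ, map_add, map_add, map_smul, map_smul,
      opG_X_pow_add_two hlam hc hF, Polynomial.smul_eq_C_mul, Polynomial.smul_eq_C_mul, ultraA]
    ring

/-- On `x ^ n`, the components of degree `n+1`, `n`, `n-1` are scaled by `1`, `F_{n+1}/F_n` and
`F_{n+1}/F_{n-1}`, which removes `1+λ(n+c)` from the middle one and supplies both denominators of
the last. -/
theorem assocRaising_eq_conj_shefferRaising (hlam : lam ≠ 0)
    (hF : ∀ n : ℕ, 1 + lam * (n + c) ≠ 0) :
    assocRaising (ultraA a) (ultraB b lam) c =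
      (diag (seqF lam c))⁻¹ʳ * shefferRaising a b lam c * diag (fun n => seqF lam c (n + 1)) := by
  rw [inverse_diag (seqF_ne_zero hlam hF)]
  refine linearMap_ext_X_pow fun n => ?_
  rw [Module.End.mul_apply, Module.End.mul_apply, diag_X_pow, map_smul, map_smul, shefferRaising]
  cases n with
  | zero =>
    have h1 := seqF_ne_zero hlam hF 1
    have h2 := hF 0
    rw [Nat.cast_zero, zero_add] at h2
    rw [assocRaising_X_pow_zero, assocRaising_X_pow_zero, map_add, map_smul, diag_X_pow,
      diag_X_pow, smul_add, smul_smul, smul_smul, smul_smul, ← seqF_succ hlam hF 0, Nat.cast_zero,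
      zero_add, zero_add c, mul_inv_cancel₀ h1, one_smul, ultraA]
    congr 2
    field_simp
  | succ n =>
    have h1 := seqF_ne_zero hlam hF (n + 2)
    have h2 := hF n
    have h3 := hF (n + 1)
    rw [assocRaising_X_pow_succ, assocRaising_X_pow_succ, map_add, map_add, map_smul, map_smul,
      diag_X_pow, diag_X_pow, diag_X_pow, smul_add, smul_add, smul_smul, smul_smul, smul_smul,
      smul_smul, smul_smul, ← seqF_succ hlam hF n, ← seqF_succ hlam hF (n + 1),
      mul_inv_cancel₀ h1, one_smul, ultraA, ultraB, show (n : ℂ) + 1 + c - 1 = n + c by ring]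
    push_cast at h3 ⊢
    congr 2
    · congr 1
      field_simp
    · field_simp

theorem assocRaising_eq_explicit :
    assocRaising (ultraA a) (ultraB b lam) c =
      mulX + a • (1 : PolyOp) +
        b • (diag (fun n => (2 + lam * (n + c)) * (1 + n + c) /
          ((1 + n) * (1 + lam * (n + c)) * (1 + lam * (n + c + 1)))) * D) := by
  refine linearMap_ext_X_pow fun n => ?_
  simp only [assocRaising, ultraA, ultraB, LinearMap.add_apply, LinearMap.smul_apply,
    Module.End.mul_apply, Module.End.one_apply, D_X_pow, map_smul, diag_X_pow, smul_smul]
  congr 2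
  rw [show ((n - 1 : ℕ) : ℂ) + c + 1 - 1 = ((n - 1 : ℕ) : ℂ) + c by ring]
  simp only [div_eq_mul_inv, mul_inv]
  ring

end Transpose

end UltrasphericalAssociated

open UltrasphericalAssociated in
open scoped Ring in
theorem mainTheorem7 (a b lam c : ℂ) (hlam : lam ≠ 0)
    (hc : ∀ n : ℕ, c + n + 1 ≠ 0) (hF : ∀ n : ℕ, 1 + lam * (n + c) ≠ 0) :
    IsUnit (opG a b lam c) ∧
    (∀ n : ℕ, opG a b lam c (Polynomial.X ^ n) = assocPoly (ultraA a) (ultraB b lam) c n) ∧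
    (opG a b lam c)⁻¹ʳ * mulX * opG a b lam c = assocRaising (ultraA a) (ultraB b lam) c ∧
    assocRaising (ultraA a) (ultraB b lam) c =
      (diag (seqF lam c))⁻¹ʳ * shefferRaising a b lam c * diag (fun n => seqF lam c (n + 1)) ∧
    assocRaising (ultraA a) (ultraB b lam) c =
      mulX + a • (1 : PolyOp) +
        b • (diag (fun n => (2 + lam * (n + c)) * (1 + n + c) /
          ((1 + n) * (1 + lam * (n + c)) * (1 + lam * (n + c + 1)))) * D) := by
  have hG := isUnit_opG (a := a) (b := b) hlam hc hF
  refine ⟨hG, opG_X_pow hlam hc hF, ?_, assocRaising_eq_conj_shefferRaising hlam hF,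
    assocRaising_eq_explicit⟩
  rw [mul_assoc, mulX_mul_opG hlam hc hF, Ring.inverse_mul_cancel_left _ _ hG]
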